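/- **Setting.** Let $\mathcal X\subseteq\mathbb R^n$ be a measurable safe set with $0<\mathrm{vol}(\mathcal X)<\infty$, let $P$ be the uniform probability distribution on $\mathcal X$, let $\mathbb U\subseteq\mathbb R^s$ be compact and let $f:\mathbb R^n\times\mathbb U\to\mathbb R^n$ be continuous (dynamics $x(t+1)=f(x(t),u(t))$). Let $h(a,x)$, $a\in\mathbb R^m$, $x\in\mathbb R^n$, be affine in $a$ for each $x$, measurable in $x$, and $h(a,x)<0$ for all $a$ and all $x\notin\mathcal X$. Fix controls $u_1,\dots,u_M\in\mathbb U$, measurable weight functions $w_1^L,\dots,w_M^L$ on $\mathbb R^n$ that on $\mathcal X$ satisfy $w_j^L\ge 0$ and $\sum_j w_j^L=1$ (for instance, weights learned beforehand from a separate data set), states $x_0,x_1',\dots,x_{N'}'\in\mathcal X$, and constants $\gamma\in(0,1)$, $\epsilon_0>0$, $\overline\lambda>0$, $U_{a_l}\ge\epsilon_0$ $(l=1,\dots,m)$; none of these depends on the samples. For a sample $\mathbb X=(x_1,\dots,x_N)$ consider the linear program $$\min_{a\in\mathbb R^m,\ \lambda\in\mathbb R}\ \lambda\quad\text{s.t.}\quad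 \begin{cases} h(a,x_0)\ge\epsilon_0,\\ \sum_{j=1}^M w_j^L(x_i)\,h(a,f(x_i,u_j))\ \ge\ \gamma h(a,x_i)-\lambda,\quad i=1,\dots,N,\\ \lambda\in[0,\overline\lambda],\quad a_l\in[-U_{a_l},U_{a_l}],\quad l=1,\dots,m,\end{cases}\tag{1}$$ with solution $(a^*(\mathbb X),\lambda^*(\mathbb X))$. If $\lambda^*(\mathbb X)=0$, then $a^*(\mathbb X)$ is taken to be the solution of $$\max_{a\in\mathbb R^m}\ \sum_{i=1}^{N'}h(a,x_i')\quad\text{s.t.}\quad \begin{cases} h(a,x_0)\ge\epsilon_0,\\ \sum_{j=1}^M w_j^L(x_i)\,h(a,f(x_i,u_j))\ \ge\ \gamma h(a,x_i),\quad i=1,\dots,N,\\ a_l\in[-U_{a_l},U_{a_l}],\quad l=1,\dots,m.\end{cases}\tag{2}$$ If (2) has several optimal solutions, one is selected by a tie-break rule: a finite (possibly empty) list of fixed continuous convex functions $t_1,\dots,t_p$ of $a$ is given; among the optimal solutions of (2) those minimizing $t_1$ are kept, among these those minimizing $t_2$, and so on. It is assumed that for every sample in $\mathcal X^N$ at most one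 point survives (as is always the case, for example, for the coordinates $t_l(a)=a_l$, $l=1,\dots,m$). **Theorem.** Let $\alpha,\beta\in(0,1)$ and let $N\ge1$ satisfy $\alpha\ge\frac2N\left(\ln\frac1\beta+m+1\right)$. Put $\widetilde{\mathbb S}=\{x\in\mathcal X: h(a^*(\mathbb X),x)\ge0\}$. If $x_1,\dots,x_N$ are drawn independently from $P$, then with confidence at least $1-\beta$ (that is, on a measurable set of samples of $P^N$-measure at least $1-\beta$) the following holds: if $\lambda^*(\mathbb X)=0$ and $P[x\in\widetilde{\mathbb S}]\ne0$, then $$P\big[\exists u\in\mathbb U:\ f(x,u)\in\widetilde{\mathbb S}\ \big|\ x\in\widetilde{\mathbb S}\big]\ \ge\ 1-\frac{\alpha}{P[x\in\widetilde{\mathbb S}]}.$$ Moreover, if $h(a,\cdot)$ is continuous on $\mathcal X$ for every $a$ and every neighbourhood of $x_0$ has positive $P$-measure (for instance, if $x_0$ is an interior point of $\mathcal X$), then $P[x\in\widetilde{\mathbb S}]\ne0$ for every sample $\mathbb X$ for which (1) has a solution. -/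

import Mathlib

open MeasureTheory Topology

noncomputable section

/-- Minimizers of `t` over the set `K`. -/
def argminOn {V : Type*} (t : V → ℝ) (K : Set V) : Set V :=
  {a | a ∈ K ∧ ∀ b ∈ K, t a ≤ t b}

/-- Successive tie-breaking: among the points of `K` keep those that minimize the first function,
among these those that minimize the second one, and so on. -/
def tieBreak {V : Type*} : List (V → ℝ) → Set V → Set V
  | [], K => K
  | t :: ts, K => tieBreak ts (argminOn t K)

/-- The data of the synthesis problem: state dimension `n`, control dimension `s`, `m` template
parameters, `M` sampled controls, and `N'` fixed points in the volume surrogate. -/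
structure CSISData (n s m M N' : ℕ) where
  /-- the safe set -/
  X : Set (EuclideanSpace ℝ (Fin n))
  /-- the set of admissible controls -/
  U : Set (EuclideanSpace ℝ (Fin s))
  /-- the dynamics `x(t+1) = f (x(t)) (u(t))` -/
  f : EuclideanSpace ℝ (Fin n) → EuclideanSpace ℝ (Fin s) → EuclideanSpace ℝ (Fin n)
  /-- the barrier template `h(a, x)` -/
  h : (Fin m → ℝ) → EuclideanSpace ℝ (Fin n) → ℝ
  /-- the sampled controls -/
  u : Fin M → EuclideanSpace ℝ (Fin s)
  /-- the fixed weight functions -/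
  w : Fin M → EuclideanSpace ℝ (Fin n) → ℝ
  /-- the state at which the template has to be at least `ε₀` -/
  x₀ : EuclideanSpace ℝ (Fin n)
  ε₀ : ℝ
  γ : ℝ
  /-- upper bound for the slack variable -/
  lamBar : ℝ
  /-- bounds for the absolute values of the parameters -/
  bound : Fin m → ℝ
  /-- the fixed states in the volume surrogate -/
  x' : Fin N' → EuclideanSpace ℝ (Fin n)
  /-- further tie-break functions, used only if the volume surrogate leaves several optima -/
  ties : List ((Fin m → ℝ) → ℝ)

namespace CSISData

variable {n s m M N' : ℕ} (D : CSISData n s m M N')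

/-- The uniform distribution on the safe set. -/
def P : Measure (EuclideanSpace ℝ (Fin n)) := ProbabilityTheory.cond volume D.X

/-- The set of `(a, lam)` satisfying the constraints of the linear program built from the
samples `ω`. -/
def feasible {N : ℕ} (ω : Fin N → EuclideanSpace ℝ (Fin n)) : Set ((Fin m → ℝ) × ℝ) :=
  {z | D.ε₀ ≤ D.h z.1 D.x₀ ∧
    (∀ i, D.γ * D.h z.1 (ω i) - z.2 ≤ ∑ j, D.w j (ω i) * D.h z.1 (D.f (ω i) (D.u j))) ∧
    z.2 ∈ Set.Icc 0 D.lamBar ∧ ∀ l, z.1 l ∈ Set.Icc (-D.bound l) (D.bound l)}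

/-- The optimal solutions of the linear program: minimize `lam` over the feasible set. -/
def lpOptimal {N : ℕ} (ω : Fin N → EuclideanSpace ℝ (Fin n)) : Set ((Fin m → ℝ) × ℝ) :=
  argminOn Prod.snd (D.feasible ω)

/-- The feasible set of the second program, where the slack variable is absent. -/
def feasibleZero {N : ℕ} (ω : Fin N → EuclideanSpace ℝ (Fin n)) : Set (Fin m → ℝ) :=
  {a | D.ε₀ ≤ D.h a D.x₀ ∧
    (∀ i, D.γ * D.h a (ω i) ≤ ∑ j, D.w j (ω i) * D.h a (D.f (ω i) (D.u j))) ∧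
    ∀ l, a l ∈ Set.Icc (-D.bound l) (D.bound l)}

/-- The optimal solutions of the second program: maximize the volume surrogate. -/
def surrogateOptimal {N : ℕ} (ω : Fin N → EuclideanSpace ℝ (Fin n)) : Set (Fin m → ℝ) :=
  {a | a ∈ D.feasibleZero ω ∧ ∀ b ∈ D.feasibleZero ω, ∑ i, D.h b (D.x' i) ≤ ∑ i, D.h a (D.x' i)}

/-- The optima of the second program that survive all the tie-break functions. -/
def selected {N : ℕ} (ω : Fin N → EuclideanSpace ℝ (Fin n)) : Set (Fin m → ℝ) :=
  tieBreak D.ties (D.surrogateOptimal ω)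

/-- `(a, lam)` is the solution `(a*(ω), λ*(ω))` returned for the samples `ω`: it is optimal for the
linear program, and if `lam = 0` then `a` is obtained from the second program. -/
structure IsSolution {N : ℕ} (ω : Fin N → EuclideanSpace ℝ (Fin n)) (a : Fin m → ℝ) (lam : ℝ) :
    Prop where
  optimal : (a, lam) ∈ D.lpOptimal ω
  tie_break : lam = 0 → a ∈ D.selected ω

/-- The set `{x ∈ X | h(a, x) ≥ 0}`. -/
def S (a : Fin m → ℝ) : Set (EuclideanSpace ℝ (Fin n)) := {x | x ∈ D.X ∧ 0 ≤ D.h a x}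

/-- `T` is a probabilistic one-step controlled safety invariant set with respect to `α`. -/
def IsProbabilisticCSIS (α : ℝ) (T : Set (EuclideanSpace ℝ (Fin n))) : Prop :=
  T ⊆ D.X ∧ D.P T ≠ 0 ∧
    1 - α / D.P.real T ≤ (ProbabilityTheory.cond D.P T).real {x | ∃ v ∈ D.U, D.f x v ∈ T}

end CSISData

end

/-!
If the margin of the one-step condition is nonnegative at a state of `D.S a`, then a weighted mean
of the values of the template at the successor states is nonnegative, so one of the sampled controls
keeps the state in `D.S a`. It remains to bound the probability that the selected parameter violates
the one-step condition on a set of states of probability more than `α`.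

A point is the lexicographic optimum of a convex program exactly when no feasible point precedes it
lexicographically. The points preceding it form a convex set, so Helly's theorem leaves at most `m`
of the sampled constraints that already determine the optimum. Split the `N` samples into a set `T`
and its complement. Given the samples in `T`, the event that their optimum has violation probability
more than `α` while all remaining samples satisfy its constraint has probability at most
`(1 - α) ^ (N - #T)`. A bad sample lies in this event for every `T` containing the support
constraints and one fixed index, hence for at least `2 ^ (N - m - 1)` sets `T`, and Markov's
inequality bounds the probability of a bad sample by
`2 ^ (m + 1) * (1 - α / 2) ^ N ≤ 2 ^ (m + 1) * exp (-α * N / 2) ≤ β`.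

The events are measurable because they are projections of measurable sets along which the optimum is
unique, and injective measurable images of Borel sets are Borel.
-/

open Finset Module

section LexicographicOptimization

variable {V : Type*}

theorem mem_tieBreak_iff {ts : List (V → ℝ)} {K : Set V} {a : V} :
    a ∈ tieBreak ts K ↔ a ∈ K ∧ ∀ b ∈ K, ts.map (· a) ≤ ts.map (· b) := by
  induction ts generalizing K with
  | nil => simp [tieBreak]
  | cons t ts ih =>
    simp only [tieBreak, ih, argminOn, Set.mem_ofPred_eq, List.map_cons, ← not_lt,
      List.cons_lt_cons_iff, not_or, not_and]
    constructor
    · rintro ⟨⟨haK, hmin⟩, hlex⟩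
      exact ⟨haK, fun b hb => ⟨hmin b hb, fun hba => hlex b ⟨hb, fun c hc => hba ▸ hmin c hc⟩⟩⟩
    · rintro ⟨haK, hlex⟩
      refine ⟨⟨haK, fun b hb => (hlex b hb).1⟩, fun b hb => (hlex b hb.1).2 ?_⟩
      exact le_antisymm (not_lt.1 (hb.2 a haK)) (not_lt.1 (hlex b hb.1).1)

theorem tieBreak_subset (ts : List (V → ℝ)) (K : Set V) : tieBreak ts K ⊆ K :=
  fun _ ha => (mem_tieBreak_iff.1 ha).1

variable [AddCommGroup V] [Module ℝ V]

theorem convex_setOf_map_lt {ts : List (V → ℝ)} (hts : ∀ t ∈ ts, ConvexOn ℝ Set.univ t)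
    (l : List ℝ) : Convex ℝ {b | ts.map (· b) < l} := by
  induction ts generalizing l with
  | nil =>
    simp only [List.map_nil]
    exact fun _ hx _ _ _ _ _ _ _ => hx
  | cons t ts ih =>
    obtain _ | ⟨r, l⟩ := l
    · simp [convex_empty]
    have ht : ConvexOn ℝ Set.univ t := hts t List.mem_cons_self
    have htie : Convex ℝ {b | ts.map (· b) < l} :=
      ih (fun t' ht' => hts t' (List.mem_cons_of_mem _ ht')) l
    rw [convex_iff_forall_pos] at htie ⊢
    simp only [List.map_cons, List.cons_lt_cons_iff, Set.mem_ofPred_eq] at htie ⊢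
    intro x hx y hy p q hp hq hpq
    have hxr : t x ≤ r := hx.elim le_of_lt fun h => h.1.le
    have hyr : t y ≤ r := hy.elim le_of_lt fun h => h.1.le
    have hcomb : t (p • x + q • y) ≤ p * t x + q * t y :=
      ht.2 (Set.mem_univ x) (Set.mem_univ y) hp.le hq.le hpq
    have hr : p * r + q * r = r := by rw [← add_mul, hpq, one_mul]
    have hpx := mul_le_mul_of_nonneg_left hxr hp.le
    have hqy := mul_le_mul_of_nonneg_left hyr hq.le
    refine (hcomb.trans ((add_le_add hpx hqy).trans hr.le)).lt_or_eq.imp_right fun heq => ?_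
    have hx_eq : t x = r := mul_left_cancel₀ hp.ne' (by linarith)
    have hy_eq : t y = r := mul_left_cancel₀ hq.ne' (by linarith)
    exact ⟨heq, htie (hx.resolve_left hx_eq.not_lt).2 (hy.resolve_left hy_eq.not_lt).2 hp hq hpq⟩

theorem exists_support_constraints [FiniteDimensional ℝ V] {ι : Type*} {ts : List (V → ℝ)}
    (hts : ∀ t ∈ ts, ConvexOn ℝ Set.univ t) {B : Set V} (hB : Convex ℝ B) {s : Finset ι}
    {C : ι → Set V} (hC : ∀ i ∈ s, Convex ℝ (C i)) {a : V}
    (ha : a ∈ tieBreak ts {b | b ∈ B ∧ ∀ i ∈ s, b ∈ C i}) :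
    ∃ I ⊆ s, #I ≤ finrank ℝ V ∧
      ∀ T, I ⊆ T → T ⊆ s → a ∈ tieBreak ts {b | b ∈ B ∧ ∀ i ∈ T, b ∈ C i} := by
  classical
  simp only [mem_tieBreak_iff, Set.mem_ofPred_eq] at ha ⊢
  obtain ⟨⟨haB, haC⟩, hmin⟩ := ha
  let F : Option ι → Set V := fun o => o.elim (B ∩ {b | ts.map (· b) < ts.map (· a)}) C
  have hF : ∀ o ∈ insertNone s, Convex ℝ (F o) := by
    simp only [forall_mem_insertNone]
    exact ⟨hB.inter (convex_setOf_map_lt hts _), hC⟩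
  have hempty : ¬ (⋂ o ∈ insertNone s, F o).Nonempty := by
    rintro ⟨b, hb⟩
    simp only [Set.mem_iInter, forall_mem_insertNone] at hb
    exact (hmin b ⟨hb.1.1, hb.2⟩).not_gt hb.1.2
  obtain ⟨J, hJs, hJcard, hJ⟩ : ∃ J ⊆ insertNone s, #J ≤ finrank ℝ V + 1 ∧
      ¬ (⋂ o ∈ J, F o).Nonempty := by
    by_contra! h
    exact hempty (Convex.helly_theorem' hF h)
  have hnone : none ∈ J := by
    by_contra hnone
    refine hJ ⟨a, Set.mem_iInter₂.2 ?_⟩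
    rintro (_ | i) hi
    · exact absurd hi hnone
    · exact haC i (some_mem_insertNone.1 (hJs hi))
  refine ⟨J.eraseNone, fun i hi => some_mem_insertNone.1 (hJs (mem_eraseNone.1 hi)), ?_,
    fun T hJT hTs => ⟨⟨haB, fun i hi => haC i (hTs hi)⟩, fun b hb => ?_⟩⟩
  · have := card_eraseNone_of_mem hnone
    omega
  · by_contra! hlt
    refine hJ ⟨b, Set.mem_iInter₂.2 ?_⟩
    rintro (_ | i) hi
    · exact ⟨hb.1, hlt⟩
    · exact hb.2 i (hJT (mem_eraseNone.2 hi))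

end LexicographicOptimization

section MeasurableMultifunctions

variable {Ω V ι : Type*} [MeasurableSpace Ω] [TopologicalSpace V]

/-- Measurability of a set-valued map, in the strong sense that the sets of points whose value meets
a given closed set are measurable. It is used to show that the set of optimal solutions depends
measurably on the data of a program. -/
def MeasurableMultifunction (K : Ω → Set V) : Prop :=
  ∀ C : Set V, IsClosed C → MeasurableSet {ω | (K ω ∩ C).Nonempty}

theorem exists_mem_forall_nonneg_iff [FirstCountableTopology V] {B : Set V} (hB : IsCompact B)
    {Q : Set B} (hQ : Dense Q) (s : Finset ι) {φ : ι → V → ℝ} (hφ : ∀ i, Continuous (φ i)) :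
    (∃ a ∈ B, ∀ i ∈ s, 0 ≤ φ i a) ↔ ∀ k : ℕ, ∃ q ∈ Q, ∀ i ∈ s, -(1 / ((k : ℝ) + 1)) < φ i q := by
  constructor
  · rintro ⟨a, haB, ha⟩ k
    have hopen : IsOpen (⋂ i ∈ s, {b : B | -(1 / ((k : ℝ) + 1)) < φ i b}) :=
      isOpen_biInter_finset fun i _ =>
        isOpen_lt continuous_const ((hφ i).comp continuous_subtype_val)
    have hneg : -(1 / ((k : ℝ) + 1)) < 0 := neg_neg_of_pos Nat.one_div_pos_of_nat
    obtain ⟨q, hqQ, hq⟩ := hQ.exists_mem_open hopen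
      ⟨⟨a, haB⟩, Set.mem_iInter₂.2 fun i hi => hneg.trans_le (ha i hi)⟩
    exact ⟨q, hqQ, Set.mem_iInter₂.1 hq⟩
  · intro h
    choose q _ hq using h
    obtain ⟨a, haB, σ, hσ, hlim⟩ := hB.tendsto_subseq fun k => (q k).2
    refine ⟨a, haB, fun i hi => ?_⟩
    have hzero := (tendsto_one_div_add_atTop_nhds_zero_nat (𝕜 := ℝ)).neg.comp hσ.tendsto_atTop
    rw [neg_zero] at hzero
    exact le_of_tendsto_of_tendsto' hzero (((hφ i).tendsto a).comp hlim) fun k => (hq _ i hi).le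

theorem measurableSet_exists_mem_forall_nonneg [SecondCountableTopology V] {B : Set V}
    (hB : IsCompact B) (s : Finset ι) {φ : ι → Ω → V → ℝ} (hφm : ∀ i a, Measurable fun ω => φ i ω a)
    (hφc : ∀ i ω, Continuous (φ i ω)) : MeasurableSet {ω | ∃ a ∈ B, ∀ i ∈ s, 0 ≤ φ i ω a} := by
  obtain ⟨Q, hQ, hQd⟩ := TopologicalSpace.exists_countable_dense B
  have hinter : {ω | ∃ a ∈ B, ∀ i ∈ s, 0 ≤ φ i ω a} =
      ⋂ k : ℕ, ⋃ q ∈ Q, ⋂ i ∈ s, {ω | -(1 / ((k : ℝ) + 1)) < φ i ω q} := by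
    ext ω
    simp [exists_mem_forall_nonneg_iff hB hQd s fun i => hφc i ω]
  rw [hinter]
  exact MeasurableSet.iInter fun k => MeasurableSet.biUnion hQ fun q _ =>
    s.measurableSet_biInter fun i _ => measurableSet_lt measurable_const (hφm i q)

theorem measurableMultifunction_setOf_forall_nonneg [SecondCountableTopology V] {B : Set V}
    (hB : IsCompact B) (s : Finset ι) {φ : ι → Ω → V → ℝ}
    (hφm : ∀ i a, Measurable fun ω => φ i ω a) (hφc : ∀ i ω, Continuous (φ i ω)) :
    MeasurableMultifunction fun ω => {a | a ∈ B ∧ ∀ i ∈ s, 0 ≤ φ i ω a} := by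
  intro C hC
  have hmeets : ∀ ω, ({a | a ∈ B ∧ ∀ i ∈ s, 0 ≤ φ i ω a} ∩ C).Nonempty ↔
      ∃ a ∈ B ∩ C, ∀ i ∈ s, 0 ≤ φ i ω a := fun ω =>
    exists_congr fun a => and_right_comm
  simp only [hmeets]
  exact measurableSet_exists_mem_forall_nonneg (hB.inter_right hC) s hφm hφc

theorem isClosed_argminOn {K : Set V} (hK : IsClosed K) {t : V → ℝ} (ht : Continuous t) :
    IsClosed (argminOn t K) := by
  have : argminOn t K = K ∩ ⋂ b ∈ K, {a | t a ≤ t b} := by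
    ext a
    simp [argminOn]
  rw [this]
  exact hK.inter (isClosed_biInter fun b _ => isClosed_le ht continuous_const)

theorem isClosed_tieBreak {ts : List (V → ℝ)} (hts : ∀ t ∈ ts, Continuous t) {K : Set V}
    (hK : IsClosed K) : IsClosed (tieBreak ts K) := by
  induction ts generalizing K with
  | nil => exact hK
  | cons t ts ih =>
    rw [List.forall_mem_cons] at hts
    exact ih hts.2 (isClosed_argminOn hK hts.1)

theorem argminOn_inter_nonempty_iff {K C : Set V} (hK : IsCompact K) (hC : IsClosed C)
    {t : V → ℝ} (ht : Continuous t) :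
    (argminOn t K ∩ C).Nonempty ↔ (K ∩ C).Nonempty ∧ ∀ r : ℚ,
      (K ∩ {a | t a ≤ r}).Nonempty → (K ∩ (C ∩ {a | t a ≤ r})).Nonempty := by
  constructor
  · rintro ⟨a, ⟨haK, hmin⟩, haC⟩
    exact ⟨⟨a, haK, haC⟩, fun r ⟨b, hbK, hbr⟩ => ⟨a, haK, haC, (hmin b hbK).trans hbr⟩⟩
  · rintro ⟨hne, h⟩
    obtain ⟨a, ⟨haK, haC⟩, hmin⟩ := (hK.inter_right hC).exists_isMinOn hne ht.continuousOn
    refine ⟨a, ⟨haK, fun b hbK => le_of_not_gt fun hba => ?_⟩, haC⟩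
    obtain ⟨r, hbr, hra⟩ := exists_rat_btwn hba
    obtain ⟨c, hcK, hcC, hcr⟩ := h r ⟨b, hbK, hbr.le⟩
    exact (hra.trans_le (hmin ⟨hcK, hcC⟩)).not_ge hcr

namespace MeasurableMultifunction

variable {K : Ω → Set V}

protected theorem argminOn (hK : MeasurableMultifunction K) (hKc : ∀ ω, IsCompact (K ω))
    {t : V → ℝ} (ht : Continuous t) : MeasurableMultifunction fun ω => argminOn t (K ω) := by
  intro C hC
  have hle : ∀ r : ℚ, IsClosed {a | t a ≤ r} := fun r => isClosed_le ht continuous_const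
  simp only [argminOn_inter_nonempty_iff (hKc _) hC ht, Set.ofPred_and, Set.ofPred_forall]
  exact (hK C hC).inter (MeasurableSet.iInter fun r => (hK _ (hle r)).imp (hK _ (hC.inter (hle r))))

protected theorem tieBreak [T2Space V] (hK : MeasurableMultifunction K) (hKc : ∀ ω, IsCompact (K ω))
    {ts : List (V → ℝ)} (hts : ∀ t ∈ ts, Continuous t) :
    MeasurableMultifunction fun ω => tieBreak ts (K ω) := by
  induction ts generalizing K with
  | nil => exact hK
  | cons t ts ih =>
    rw [List.forall_mem_cons] at hts
    refine ih (hK.argminOn hKc hts.1) (fun ω => ?_) hts.2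
    exact (hKc ω).of_isClosed_subset (isClosed_argminOn (hKc ω).isClosed hts.1) fun a ha => ha.1

theorem measurableSet_graph [RegularSpace V] [SecondCountableTopology V] [MeasurableSpace V]
    [OpensMeasurableSpace V] (hK : MeasurableMultifunction K) (hKc : ∀ ω, IsClosed (K ω)) :
    MeasurableSet {p : Ω × V | p.2 ∈ K p.1} := by
  let 𝒪 := TopologicalSpace.countableBasis V
  have h𝒪 : TopologicalSpace.IsTopologicalBasis 𝒪 := TopologicalSpace.isBasis_countableBasis V
  have hcompl : {p : Ω × V | p.2 ∈ K p.1}ᶜ =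
      ⋃ O ∈ 𝒪, {ω | (K ω ∩ closure O).Nonempty}ᶜ ×ˢ O := by
    ext ⟨ω, a⟩
    simp only [Set.mem_compl_iff, Set.mem_ofPred_eq, Set.mem_iUnion, Set.mem_prod, exists_prop]
    constructor
    · intro ha
      obtain ⟨O, hO, haO, hOK⟩ := h𝒪.exists_closure_subset ((hKc ω).isOpen_compl.mem_nhds ha)
      exact ⟨O, hO, fun ⟨b, hbK, hbO⟩ => hOK hbO hbK, haO⟩
    · rintro ⟨O, -, hO, haO⟩ haK
      exact hO ⟨a, haK, subset_closure haO⟩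
  refine MeasurableSet.of_compl ?_
  rw [hcompl]
  exact MeasurableSet.biUnion (TopologicalSpace.countable_countableBasis V) fun O hO =>
    (hK _ isClosed_closure).compl.prod (h𝒪.isOpen hO).measurableSet

end MeasurableMultifunction

end MeasurableMultifunctions

section ProductMeasures

theorem measure_pi_le_of_forall_updateFinset {ι : Type*} {Ω : ι → Type*} [Fintype ι] [DecidableEq ι]
    [∀ i, MeasurableSpace (Ω i)] (P : ∀ i, Measure (Ω i)) [∀ i, IsProbabilityMeasure (P i)]
    {A : Set (∀ i, Ω i)} (hA : MeasurableSet A) (s : Finset ι) {c : ENNReal}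
    (h : ∀ ω, Measure.pi (fun i : s => P i) {z | Function.updateFinset ω s z ∈ A} ≤ c) :
    Measure.pi P A ≤ c := by
  calc Measure.pi P A = ∫⁻ ω, A.indicator 1 ω ∂Measure.pi P := (lintegral_indicator_one hA).symm
    _ ≤ ∫⁻ _, c ∂Measure.pi P := by
        refine lintegral_le_of_lmarginal_le s (measurable_one.indicator hA) measurable_const
          fun ω => ?_
        have hsection : MeasurableSet {z | Function.updateFinset ω s z ∈ A} :=
          measurable_updateFinset hA
        simp only [lmarginal, lintegral_const, measure_univ, mul_one]
        exact (lintegral_indicator_one hsection).trans_le (h ω)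
    _ = c := by simp

/-- Markov's inequality for the number of sets `T` with `ω ∈ A T`: it is at least
`2 ^ (card ι - d)` on `E`, and its integral is at most `(1 + q) ^ card ι`. -/
theorem two_pow_mul_measure_le {ι Ω : Type*} [Fintype ι] [MeasurableSpace Ω] {μ : Measure Ω}
    {A : Finset ι → Set Ω} (hA : ∀ T, MeasurableSet (A T)) {q : ENNReal}
    (hAq : ∀ T, μ (A T) ≤ q ^ (Fintype.card ι - #T)) {E : Set Ω} {d : ℕ}
    (hE : ∀ ω ∈ E, ∃ I : Finset ι, #I ≤ d ∧ ∀ T, I ⊆ T → ω ∈ A T) :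
    2 ^ Fintype.card ι * μ E ≤ 2 ^ d * (1 + q) ^ Fintype.card ι := by
  classical
  let F : Ω → ENNReal := fun ω => ∑ T, (A T).indicator 1 ω
  have hF : Measurable F := Finset.measurable_sum _ fun T _ => measurable_one.indicator (hA T)
  have hcount : ∀ ω ∈ E, 2 ^ Fintype.card ι ≤ 2 ^ d * F ω := by
    intro ω hω
    obtain ⟨I, hId, hI⟩ := hE ω hω
    have hsupersets : (2 : ENNReal) ^ (Fintype.card ι - #I) ≤ F ω := by
      calc (2 : ENNReal) ^ (Fintype.card ι - #I) = ∑ T ∈ Icc I univ, 1 := by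
            simp [card_Icc_finset (subset_univ I)]
        _ = ∑ T ∈ Icc I univ, (A T).indicator 1 ω :=
            sum_congr rfl fun T hT => by simp [hI T (mem_Icc.1 hT).1]
        _ ≤ F ω := sum_le_sum_of_subset (subset_univ _)
    calc (2 : ENNReal) ^ Fintype.card ι = 2 ^ #I * 2 ^ (Fintype.card ι - #I) := by
          rw [← pow_add, Nat.add_sub_cancel' I.card_le_univ]
      _ ≤ 2 ^ d * F ω := by gcongr; norm_num
  calc 2 ^ Fintype.card ι * μ E
      ≤ 2 ^ Fintype.card ι * μ {ω | 2 ^ Fintype.card ι ≤ 2 ^ d * F ω} := by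
        gcongr
        exact hcount
    _ ≤ ∫⁻ ω, 2 ^ d * F ω ∂μ := mul_meas_ge_le_lintegral (hF.const_mul _) _
    _ = 2 ^ d * ∑ T, μ (A T) := by
        rw [lintegral_const_mul _ hF,
          lintegral_finsetSum _ fun T _ => measurable_one.indicator (hA T)]
        simp only [lintegral_indicator_one (hA _)]
    _ ≤ 2 ^ d * ∑ T, 1 ^ #T * q ^ (Fintype.card ι - #T) := by
        simp only [one_pow, one_mul]
        gcongr with T
        exact hAq T
    _ = 2 ^ d * (1 + q) ^ Fintype.card ι := by rw [Fintype.sum_pow_mul_eq_add_pow]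

end ProductMeasures

section ScenarioProgram

variable {ι Ω V : Type*}

/-- The lexicographic optima over `B` of the program whose constraints `0 ≤ g a (ω i)` are imposed
for the scenarios `i ∈ T` only; the objective is the first function of the list `ts`, the tie-break
functions are the others. -/
def scenarioOptimal (B : Set V) (g : V → Ω → ℝ) (ts : List (V → ℝ)) (T : Finset ι) (ω : ι → Ω) :
    Set V :=
  tieBreak ts {a | a ∈ B ∧ ∀ i ∈ T, 0 ≤ g a (ω i)}

variable {X : Set Ω} {B : Set V} {g : V → Ω → ℝ} {ts : List (V → ℝ)} {T : Finset ι} {α : ℝ}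

theorem scenarioOptimal_congr {ω ω' : ι → Ω} (h : ∀ i ∈ T, ω i = ω' i) :
    scenarioOptimal B g ts T ω = scenarioOptimal B g ts T ω' := by
  have : ∀ a, (∀ i ∈ T, 0 ≤ g a (ω i)) ↔ ∀ i ∈ T, 0 ≤ g a (ω' i) := fun a =>
    forall₂_congr fun i hi => by rw [h i hi]
  simp only [scenarioOptimal, this]

theorem scenarioOptimal_subsingleton [Fintype ι]
    (huniq : ∀ ω : ι → Ω, (∀ i, ω i ∈ X) → (scenarioOptimal B g ts univ ω).Subsingleton)
    (hT : T.Nonempty) {ω : ι → Ω} (hω : ∀ i ∈ T, ω i ∈ X) :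
    (scenarioOptimal B g ts T ω).Subsingleton := by
  classical
  obtain ⟨i₀, hi₀⟩ := hT
  let r : ι → ι := fun i => if i ∈ T then i else i₀
  have hr : ∀ i, r i ∈ T := fun i => by grind
  have hrT : ∀ i ∈ T, r i = i := fun i hi => if_pos hi
  have hrepeat : scenarioOptimal B g ts T ω = scenarioOptimal B g ts univ (ω ∘ r) := by
    have : ∀ a, (∀ i ∈ T, 0 ≤ g a (ω i)) ↔ ∀ i ∈ (univ : Finset ι), 0 ≤ g a ((ω ∘ r) i) :=
      fun a => ⟨fun h i _ => h _ (hr i), fun h i hi => by simpa [hrT i hi] using h i (mem_univ i)⟩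
    simp only [scenarioOptimal, this]
  rw [hrepeat]
  exact huniq _ fun i => hω _ (hr i)

variable [MeasurableSpace Ω] {P : Measure Ω}

/-- The event that the optimum for the scenarios in `T` violates a fresh constraint with probability
more than `α`, although it satisfies the constraints of all the scenarios outside `T`. The optimum
is unique on this event, since the scenarios in `T` lie in `X`. -/
def undetectedViolation (P : Measure Ω) (X : Set Ω) (B : Set V) (g : V → Ω → ℝ)
    (ts : List (V → ℝ)) (α : ℝ) (T : Finset ι) : Set (ι → Ω) :=
  {ω | (T.Nonempty ∧ ∀ i ∈ T, ω i ∈ X) ∧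
    ∃ a ∈ scenarioOptimal B g ts T ω, α < P.real {x | g a x < 0} ∧ ∀ i ∉ T, 0 ≤ g a (ω i)}

theorem prob_nonneg_le_of_lt_prob_neg [IsProbabilityMeasure P] {φ : Ω → ℝ} (hφ : Measurable φ)
    (h : α < P.real {x | φ x < 0}) : P {x | 0 ≤ φ x} ≤ ENNReal.ofReal (1 - α) := by
  have hcompl : {x | 0 ≤ φ x} = {x | φ x < 0}ᶜ := by
    ext
    simp
  rw [hcompl, ← ofReal_measureReal,
    probReal_compl_eq_one_sub (measurableSet_lt hφ measurable_const)]
  exact ENNReal.ofReal_le_ofReal (by linarith)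

variable [TopologicalSpace V]

theorem measurableSet_graph_scenarioOptimal [T3Space V] [SecondCountableTopology V]
    [MeasurableSpace V] [OpensMeasurableSpace V] (hB : IsCompact B)
    (hgc : ∀ x, Continuous fun a => g a x) (hgm : ∀ a, Measurable (g a))
    (hts : ∀ t ∈ ts, Continuous t) (T : Finset ι) :
    MeasurableSet {p : (ι → Ω) × V | p.2 ∈ scenarioOptimal B g ts T p.1} := by
  have hfeasible : MeasurableMultifunction fun ω : ι → Ω => {a | a ∈ B ∧ ∀ i ∈ T, 0 ≤ g a (ω i)} :=
    measurableMultifunction_setOf_forall_nonneg (Ω := ι → Ω) hB T (φ := fun i ω a => g a (ω i))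
      (fun i a => (hgm a).comp (measurable_pi_apply i)) fun i ω => hgc (ω i)
  have hcompact : ∀ ω : ι → Ω, IsCompact {a | a ∈ B ∧ ∀ i ∈ T, 0 ≤ g a (ω i)} := by
    intro ω
    simp only [Set.ofPred_and, Set.ofPred_forall]
    exact hB.inter_right
      (isClosed_biInter fun i _ => isClosed_le continuous_const (hgc (ω i)))
  exact (hfeasible.tieBreak hcompact hts).measurableSet_graph fun ω =>
    isClosed_tieBreak hts (hcompact ω).isClosed

variable [PolishSpace V] [MeasurableSpace V] [BorelSpace V] [StandardBorelSpace Ω] [Fintype ι]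
  [IsProbabilityMeasure P]

theorem measurableSet_undetectedViolation (hX : MeasurableSet X) (hB : IsCompact B)
    (hgc : ∀ x, Continuous fun a => g a x) (hgm : ∀ a, Measurable (g a))
    (hts : ∀ t ∈ ts, Continuous t)
    (huniq : ∀ ω : ι → Ω, (∀ i, ω i ∈ X) → (scenarioOptimal B g ts univ ω).Subsingleton)
    (α : ℝ) (T : Finset ι) : MeasurableSet (undetectedViolation P X B g ts α T) := by
  have hg : Measurable (Function.uncurry g) :=
    measurable_uncurry_of_continuous_of_measurable hgc hgm
  have hviolation : Measurable fun a => P.real {x | g a x < 0} :=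
    (measurable_measure_prodMk_left (measurableSet_lt hg measurable_const)).ennreal_toReal
  let G : Set ((ι → Ω) × V) :=
    {p | (T.Nonempty ∧ ∀ i ∈ T, p.1 i ∈ X) ∧ p.2 ∈ scenarioOptimal B g ts T p.1 ∧
      α < P.real {x | g p.2 x < 0} ∧ ∀ i ∉ T, 0 ≤ g p.2 (p.1 i)}
  have hcoord : ∀ i, Measurable fun p : (ι → Ω) × V => p.1 i := fun i => by fun_prop
  have hGX : MeasurableSet {p : (ι → Ω) × V | ∀ i ∈ T, p.1 i ∈ X} := by
    simp only [Set.ofPred_forall]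
    exact .iInter fun i => .iInter fun _ => hcoord i hX
  have hGg : MeasurableSet {p : (ι → Ω) × V | ∀ i ∉ T, 0 ≤ g p.2 (p.1 i)} := by
    simp only [Set.ofPred_forall]
    exact .iInter fun i => .iInter fun _ =>
      measurableSet_le measurable_const (hg.comp (measurable_snd.prodMk (hcoord i)))
  have hG : MeasurableSet G :=
    ((MeasurableSet.const _).inter hGX).inter
      ((measurableSet_graph_scenarioOptimal hB hgc hgm hts T).inter
        ((measurableSet_lt measurable_const (hviolation.comp measurable_snd)).inter hGg))
  have hproj : undetectedViolation P X B g ts α T = Prod.fst '' G := by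
    ext ω
    simp [undetectedViolation, G]
  rw [hproj]
  refine hG.image_of_measurable_injOn measurable_fst ?_
  rintro ⟨ω, a⟩ ⟨hω, ha, -⟩ ⟨_, b⟩ ⟨-, hb, -⟩ rfl
  exact Prod.ext rfl (scenarioOptimal_subsingleton huniq hω.1 hω.2 ha hb)

theorem measure_pi_undetectedViolation_le (hX : MeasurableSet X) (hB : IsCompact B)
    (hgc : ∀ x, Continuous fun a => g a x) (hgm : ∀ a, Measurable (g a))
    (hts : ∀ t ∈ ts, Continuous t)
    (huniq : ∀ ω : ι → Ω, (∀ i, ω i ∈ X) → (scenarioOptimal B g ts univ ω).Subsingleton)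
    (α : ℝ) (T : Finset ι) :
    Measure.pi (fun _ => P) (undetectedViolation P X B g ts α T) ≤
      ENNReal.ofReal (1 - α) ^ (Fintype.card ι - #T) := by
  classical
  refine measure_pi_le_of_forall_updateFinset _
    (measurableSet_undetectedViolation hX hB hgc hgm hts huniq α T) Tᶜ fun ω => ?_
  have hT : ∀ z, ∀ i ∈ T, Function.updateFinset ω Tᶜ z i = ω i := fun z i hi => by
    simp [Function.updateFinset, hi]
  have hTc : ∀ z, ∀ i : ↥Tᶜ, Function.updateFinset ω Tᶜ z i = z i := fun z i => by
    simp [Function.updateFinset]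
  obtain hempty | ⟨z₀, ⟨hne, hz₀⟩, a, ha, hviol, -⟩ :=
    {z | Function.updateFinset ω Tᶜ z ∈ undetectedViolation P X B g ts α T}.eq_empty_or_nonempty
  · simp [hempty]
  have hsub : {z | Function.updateFinset ω Tᶜ z ∈ undetectedViolation P X B g ts α T} ⊆
      Set.univ.pi fun _ => {x | 0 ≤ g a x} := by
    rintro z ⟨-, b, hb, -, hz⟩ i -
    rw [scenarioOptimal_congr fun i hi => (hT z i hi).trans (hT z₀ i hi).symm] at hb
    rw [← scenarioOptimal_subsingleton huniq hne hz₀ hb ha]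
    simpa [hTc] using hz i (mem_compl.1 i.2)
  calc _ ≤ Measure.pi (fun _ : ↥Tᶜ => P) (Set.univ.pi fun _ => {x | 0 ≤ g a x}) :=
        measure_mono hsub
    _ = P {x | 0 ≤ g a x} ^ (Fintype.card ι - #T) := by simp [Measure.pi_pi, card_compl]
    _ ≤ ENNReal.ofReal (1 - α) ^ (Fintype.card ι - #T) := by
        gcongr
        exact prob_nonneg_le_of_lt_prob_neg (hgm a) hviol

variable [AddCommGroup V] [Module ℝ V] [FiniteDimensional ℝ V]
theorem two_pow_mul_measure_scenario_le (hX : MeasurableSet X) (hB : IsCompact B)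
    (hBc : Convex ℝ B) (hgc : ∀ x, Continuous fun a => g a x) (hgm : ∀ a, Measurable (g a))
    (hgx : ∀ x, Convex ℝ {a | 0 ≤ g a x})
    (hts : ∀ t ∈ ts, ConvexOn ℝ Set.univ t ∧ Continuous t)
    (huniq : ∀ ω : ι → Ω, (∀ i, ω i ∈ X) → (scenarioOptimal B g ts univ ω).Subsingleton)
    [Nonempty ι] (α : ℝ) :
    2 ^ Fintype.card ι * Measure.pi (fun _ : ι => P) {ω | (∀ i, ω i ∈ X) ∧
        ∃ a ∈ scenarioOptimal B g ts univ ω, α < P.real {x | g a x < 0}} ≤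
      2 ^ (finrank ℝ V + 1) * (1 + ENNReal.ofReal (1 - α)) ^ Fintype.card ι := by
  classical
  have htc : ∀ t ∈ ts, Continuous t := fun t ht => (hts t ht).2
  refine two_pow_mul_measure_le (measurableSet_undetectedViolation hX hB hgc hgm htc huniq α)
    (measure_pi_undetectedViolation_le hX hB hgc hgm htc huniq α) ?_
  rintro ω ⟨hω, a, ha, hviol⟩
  obtain ⟨I, -, hIcard, hI⟩ := exists_support_constraints (fun t ht => (hts t ht).1) hBc
    (C := fun i => {a | 0 ≤ g a (ω i)}) (fun i _ => hgx (ω i)) ha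
  -- One more index keeps the retained scenarios nonempty when there are no support constraints.
  obtain ⟨i₀⟩ := ‹Nonempty ι›
  refine ⟨insert i₀ I, (card_insert_le _ _).trans (by gcongr), fun T hT => ?_⟩
  obtain ⟨hi₀, hIT⟩ := insert_subset_iff.1 hT
  exact ⟨⟨⟨i₀, hi₀⟩, fun i _ => hω i⟩, a, hI T hIT (subset_univ T), hviol,
    fun i _ => (tieBreak_subset _ _ ha).2 i (mem_univ i)⟩

theorem one_add_ofReal_one_sub_le (hα : α ≤ 1) :
    1 + ENNReal.ofReal (1 - α) ≤ 2 * ENNReal.ofReal (Real.exp (-(α / 2))) := by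
  have hexp : 1 - α / 2 ≤ Real.exp (-(α / 2)) := by linarith [Real.add_one_le_exp (-(α / 2))]
  rw [← ENNReal.ofReal_one, ← ENNReal.ofReal_add zero_le_one (by linarith),
    ← ENNReal.ofReal_ofNat, ← ENNReal.ofReal_mul zero_le_two]
  exact ENNReal.ofReal_le_ofReal (by linarith)

theorem measureReal_scenario_violation_le [Nonempty ι] (hX : ∀ᵐ x ∂P, x ∈ X) (hB : IsCompact B)
    (hBc : Convex ℝ B) (hgc : ∀ x, Continuous fun a => g a x) (hgm : ∀ a, Measurable (g a))
    (hgx : ∀ x, Convex ℝ {a | 0 ≤ g a x})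
    (hts : ∀ t ∈ ts, ConvexOn ℝ Set.univ t ∧ Continuous t)
    (huniq : ∀ ω : ι → Ω, (∀ i, ω i ∈ X) → (scenarioOptimal B g ts univ ω).Subsingleton)
    (hα : α ≤ 1) :
    (Measure.pi fun _ : ι => P).real
        {ω | ∃ a ∈ scenarioOptimal B g ts univ ω, α < P.real {x | g a x < 0}} ≤
      2 ^ (finrank ℝ V + 1) * Real.exp (-(α * Fintype.card ι / 2)) := by
  set E : Set (ι → Ω) := {ω | ∃ a ∈ scenarioOptimal B g ts univ ω, α < P.real {x | g a x < 0}}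
  obtain ⟨Y, hY, hYm, hYX⟩ := hX.exists_measurable_mem
  have hae : ∀ᵐ ω ∂Measure.pi fun _ : ι => P, ∀ i, ω i ∈ Y :=
    ae_all_iff.2 fun i => (Measure.quasiMeasurePreserving_eval _ i).ae hY
  have hE : Measure.pi (fun _ : ι => P) E = Measure.pi (fun _ => P) {ω | (∀ i, ω i ∈ Y) ∧ ω ∈ E} :=
    measure_congr <| by
      filter_upwards [hae] with ω hω
      exact propext ⟨fun h => ⟨hω, h⟩, fun h => h.2⟩
  have hcount : 2 ^ Fintype.card ι * Measure.pi (fun _ : ι => P) E ≤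
      2 ^ Fintype.card ι *
        (2 ^ (finrank ℝ V + 1) * ENNReal.ofReal (Real.exp (-(α / 2))) ^ Fintype.card ι) := by
    calc 2 ^ Fintype.card ι * Measure.pi (fun _ : ι => P) E
        ≤ 2 ^ (finrank ℝ V + 1) * (1 + ENNReal.ofReal (1 - α)) ^ Fintype.card ι :=
          hE ▸ two_pow_mul_measure_scenario_le hYm hB hBc hgc hgm hgx hts
            (fun ω hω => huniq ω fun i => hYX _ (hω i)) α
      _ ≤ 2 ^ (finrank ℝ V + 1) *
          (2 * ENNReal.ofReal (Real.exp (-(α / 2)))) ^ Fintype.card ι := by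
          gcongr
          exact one_add_ofReal_one_sub_le hα
      _ = _ := by ring
  have hle := (ENNReal.mul_le_mul_iff_right (by positivity) (by finiteness)).1 hcount
  calc (Measure.pi fun _ : ι => P).real E
      ≤ (2 ^ (finrank ℝ V + 1) *
          ENNReal.ofReal (Real.exp (-(α / 2))) ^ Fintype.card ι).toReal :=
        ENNReal.toReal_mono (by finiteness) hle
    _ = 2 ^ (finrank ℝ V + 1) * Real.exp (-(α / 2)) ^ Fintype.card ι := by
        simp [ENNReal.toReal_ofReal (Real.exp_pos _).le]
    _ = 2 ^ (finrank ℝ V + 1) * Real.exp (-(α * Fintype.card ι / 2)) := by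
        rw [← Real.exp_nat_mul]
        ring_nf

end ScenarioProgram

theorem two_pow_mul_exp_le {d : ℕ} {N α β : ℝ} (hN : 0 < N) (hβ : 0 < β)
    (h : 2 / N * (Real.log (1 / β) + d) ≤ α) : 2 ^ d * Real.exp (-(α * N / 2)) ≤ β := by
  have hlog : -(α * N / 2) ≤ Real.log β - d := by
    rw [div_mul_eq_mul_div, div_le_iff₀ hN, one_div, Real.log_inv] at h
    linarith
  have htwo : (2 : ℝ) ≤ Real.exp 1 := by linarith [Real.add_one_le_exp 1]
  calc (2 : ℝ) ^ d * Real.exp (-(α * N / 2)) ≤ Real.exp 1 ^ d * Real.exp (Real.log β - d) := by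
        gcongr
    _ = β := by rw [← Real.exp_nat_mul, ← Real.exp_add, mul_one, add_sub_cancel, Real.exp_log hβ]

theorem one_sub_div_le_cond {Ω : Type*} [MeasurableSpace Ω] {P : Measure Ω} [IsFiniteMeasure P]
    {S F V : Set Ω} {α : ℝ} (hS : MeasurableSet S) (hne : P S ≠ 0) (hcover : S ⊆ F ∪ V)
    (hV : P.real V ≤ α) : 1 - α / P.real S ≤ (ProbabilityTheory.cond P S).real F := by
  have hpos : 0 < P.real S := ENNReal.toReal_pos hne (measure_ne_top _ _)
  have hle : P.real S ≤ P.real (S ∩ F) + α := by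
    calc P.real S ≤ P.real (S ∩ F ∪ V) :=
          measureReal_mono fun x hx => (hcover hx).imp_left fun hF => ⟨hx, hF⟩
      _ ≤ P.real (S ∩ F) + P.real V := measureReal_union_le _ _
      _ ≤ P.real (S ∩ F) + α := by gcongr
  have hcond : (ProbabilityTheory.cond P S).real F = P.real (S ∩ F) / P.real S := by
    simp only [Measure.real, ProbabilityTheory.cond_apply hS, ENNReal.toReal_mul,
      ENNReal.toReal_inv, div_eq_inv_mul]
  rw [hcond, one_sub_div hpos.ne']
  gcongr
  linarith

theorem sum_affineMap_apply {R E F ι : Type*} [CommRing R] [AddCommGroup E] [Module R E]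
    [AddCommGroup F] [Module R F] (s : Finset ι) (A : ι → E →ᵃ[R] F) (a : E) :
    (∑ i ∈ s, A i) a = ∑ i ∈ s, A i a := by
  classical
  induction s using Finset.induction_on with
  | empty => simp
  | insert i s hi ih => simp [sum_insert hi, ih]

namespace CSISData

variable {n s m M N' : ℕ} (D : CSISData n s m M N')

/-- The margin by which the weighted one-step decrease condition holds at the state `x`; the sampled
constraints of the second program are `0 ≤ D.margin a (ω i)`. -/
def margin (a : Fin m → ℝ) (x : EuclideanSpace ℝ (Fin n)) : ℝ :=
  ∑ j, D.w j x * D.h a (D.f x (D.u j)) - D.γ * D.h a x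

/-- The sample-independent part of the feasible set. -/
def parameterSet : Set (Fin m → ℝ) :=
  {a | D.ε₀ ≤ D.h a D.x₀ ∧ ∀ l, a l ∈ Set.Icc (-D.bound l) (D.bound l)}

/-- The negated volume surrogate, which turns the second program into a minimization problem. -/
def negSurrogate (a : Fin m → ℝ) : ℝ := -∑ i, D.h a (D.x' i)

/-- The invariance notion `CSISData.IsProbabilisticCSIS` with an arbitrary distribution `P` of the
states in place of the uniform one. -/
def IsProbabilisticCSISFor (P : Measure (EuclideanSpace ℝ (Fin n))) (α : ℝ)
    (T : Set (EuclideanSpace ℝ (Fin n))) : Prop :=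
  T ⊆ D.X ∧ P T ≠ 0 ∧
    1 - α / P.real T ≤ (ProbabilityTheory.cond P T).real {x | ∃ v ∈ D.U, D.f x v ∈ T}

theorem selected_eq_scenarioOptimal {N : ℕ} (ω : Fin N → EuclideanSpace ℝ (Fin n)) :
    D.selected ω =
      scenarioOptimal D.parameterSet D.margin (D.negSurrogate :: D.ties) univ ω := by
  have hfeasible : D.feasibleZero ω =
      {a | a ∈ D.parameterSet ∧ ∀ i ∈ univ, 0 ≤ D.margin a (ω i)} := by
    ext a
    simp only [feasibleZero, parameterSet, margin, Set.mem_ofPred_eq, sub_nonneg, mem_univ,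
      forall_const]
    tauto
  rw [scenarioOptimal, selected, tieBreak, surrogateOptimal, argminOn, hfeasible]
  simp only [negSurrogate, neg_le_neg_iff]

variable {D}

section Affine

variable (hh : ∀ x, ∃ A : (Fin m → ℝ) →ᵃ[ℝ] ℝ, ∀ a, D.h a x = A a)

include hh

theorem continuous_h (x : EuclideanSpace ℝ (Fin n)) : Continuous fun a => D.h a x := by
  obtain ⟨A, hA⟩ := hh x
  simp only [hA]
  exact A.continuous_of_finiteDimensional

theorem isCompact_parameterSet : IsCompact D.parameterSet := by
  have hbox : IsCompact {a : Fin m → ℝ | ∀ l, a l ∈ Set.Icc (-D.bound l) (D.bound l)} := by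
    simpa only [Set.pi, Set.mem_univ, true_imp_iff] using
      isCompact_univ_pi fun l => isCompact_Icc (a := -D.bound l) (b := D.bound l)
  exact hbox.inter_left (isClosed_le continuous_const (continuous_h hh D.x₀))

theorem convex_parameterSet : Convex ℝ D.parameterSet := by
  have hbox : Convex ℝ {a : Fin m → ℝ | ∀ l, a l ∈ Set.Icc (-D.bound l) (D.bound l)} := by
    simpa only [Set.pi, Set.mem_univ, true_imp_iff] using
      convex_pi fun l (_ : l ∈ Set.univ) => convex_Icc (𝕜 := ℝ) (-D.bound l) (D.bound l)
  obtain ⟨A, hA⟩ := hh D.x₀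
  simp only [parameterSet, hA]
  exact ((convex_Ici D.ε₀).affine_preimage A).inter hbox

theorem exists_affineMap_margin (x : EuclideanSpace ℝ (Fin n)) :
    ∃ A : (Fin m → ℝ) →ᵃ[ℝ] ℝ, ∀ a, D.margin a x = A a := by
  choose A hA using hh
  refine ⟨∑ j, D.w j x • A (D.f x (D.u j)) - D.γ • A x, fun a => ?_⟩
  simp [margin, hA, sum_affineMap_apply]

theorem continuous_margin (x : EuclideanSpace ℝ (Fin n)) : Continuous fun a => D.margin a x := by
  obtain ⟨A, hA⟩ := exists_affineMap_margin hh x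
  simp only [hA]
  exact A.continuous_of_finiteDimensional

theorem convex_setOf_margin_nonneg (x : EuclideanSpace ℝ (Fin n)) :
    Convex ℝ {a | 0 ≤ D.margin a x} := by
  obtain ⟨A, hA⟩ := exists_affineMap_margin hh x
  simp only [hA]
  exact (convex_Ici 0).affine_preimage A

theorem continuous_negSurrogate : Continuous D.negSurrogate :=
  (continuous_finsetSum _ fun i _ => continuous_h hh (D.x' i)).neg

theorem convexOn_negSurrogate : ConvexOn ℝ Set.univ D.negSurrogate := by
  choose A hA using hh
  have : D.negSurrogate = ⇑(-∑ i, A (D.x' i)) := by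
    ext a
    simp [negSurrogate, hA, sum_affineMap_apply]
  rw [this]
  exact (convexOn_id convex_univ).comp_affineMap _

end Affine

theorem measurable_margin (hf : ∀ j, Measurable fun x => D.f x (D.u j))
    (hh : ∀ a, Measurable (D.h a)) (hw : ∀ j, Measurable (D.w j)) (a : Fin m → ℝ) :
    Measurable (D.margin a) :=
  (Finset.measurable_sum _ fun j _ => (hw j).mul ((hh a).comp (hf j))).sub ((hh a).const_mul _)

theorem S_eq_setOf_nonneg (hneg : ∀ a, ∀ x, x ∉ D.X → D.h a x < 0) (a : Fin m → ℝ) :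
    D.S a = {x | 0 ≤ D.h a x} :=
  Set.ext fun x => and_iff_right_of_imp fun hx => by_contra fun hX => (hneg a x hX).not_ge hx

theorem exists_control_of_margin_nonneg (hneg : ∀ a, ∀ x, x ∉ D.X → D.h a x < 0)
    (hu : ∀ j, D.u j ∈ D.U) (hw_nonneg : ∀ j, ∀ x ∈ D.X, 0 ≤ D.w j x)
    (hw_sum : ∀ x ∈ D.X, ∑ j, D.w j x = 1) (hγ : 0 ≤ D.γ) {a : Fin m → ℝ}
    {x : EuclideanSpace ℝ (Fin n)} (hx : x ∈ D.S a) (hmargin : 0 ≤ D.margin a x) :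
    ∃ v ∈ D.U, D.f x v ∈ D.S a := by
  have hmean : 0 ≤ ∑ j, D.w j x * D.h a (D.f x (D.u j)) :=
    (mul_nonneg hγ hx.2).trans (sub_nonneg.1 hmargin)
  obtain ⟨j, hj⟩ : ∃ j, 0 ≤ D.h a (D.f x (D.u j)) := by
    by_contra! hlt
    have : ∑ j, D.w j x • D.h a (D.f x (D.u j)) ∈ Set.Iio (0 : ℝ) :=
      (convex_Iio 0).sum_mem (fun j _ => hw_nonneg j x hx.1) (hw_sum x hx.1) fun j _ => hlt j
    exact hmean.not_gt this
  exact ⟨D.u j, hu j, (S_eq_setOf_nonneg hneg a).symm ▸ hj⟩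

theorem isProbabilisticCSISFor_S {P : Measure (EuclideanSpace ℝ (Fin n))} [IsFiniteMeasure P]
    (hneg : ∀ a, ∀ x, x ∉ D.X → D.h a x < 0) (hu : ∀ j, D.u j ∈ D.U)
    (hw_nonneg : ∀ j, ∀ x ∈ D.X, 0 ≤ D.w j x) (hw_sum : ∀ x ∈ D.X, ∑ j, D.w j x = 1)
    (hγ : 0 ≤ D.γ) {α : ℝ} {a : Fin m → ℝ} (hh : Measurable (D.h a))
    (hviol : P.real {x | D.margin a x < 0} ≤ α) (hne : P (D.S a) ≠ 0) :
    D.IsProbabilisticCSISFor P α (D.S a) := by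
  have hS : MeasurableSet (D.S a) := by
    rw [S_eq_setOf_nonneg hneg]
    exact measurableSet_le measurable_const hh
  have hcover : D.S a ⊆ {x | ∃ v ∈ D.U, D.f x v ∈ D.S a} ∪ {x | D.margin a x < 0} := fun x hx =>
    (le_or_gt 0 (D.margin a x)).imp_left
      (exists_control_of_margin_nonneg hneg hu hw_nonneg hw_sum hγ hx)
  exact ⟨fun _ hx => hx.1, hne, one_sub_div_le_cond hS hne hcover hviol⟩

theorem measureReal_selected_violation_le {P : Measure (EuclideanSpace ℝ (Fin n))}
    [IsProbabilityMeasure P] (hPX : ∀ᵐ x ∂P, x ∈ D.X)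
    (hf : ∀ j, Measurable fun x => D.f x (D.u j))
    (hh_affine : ∀ x, ∃ A : (Fin m → ℝ) →ᵃ[ℝ] ℝ, ∀ a, D.h a x = A a)
    (hh_meas : ∀ a, Measurable (D.h a)) (hw_meas : ∀ j, Measurable (D.w j)) {N : ℕ} (hN : 0 < N)
    (hties : ∀ t ∈ D.ties, ConvexOn ℝ Set.univ t ∧ Continuous t)
    (hunique : ∀ ω : Fin N → EuclideanSpace ℝ (Fin n), (∀ i, ω i ∈ D.X) →
      (D.selected ω).Subsingleton) {α : ℝ} (hα : α ≤ 1) :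
    (Measure.pi fun _ : Fin N => P).real
        {ω | ∃ a ∈ D.selected ω, α < P.real {x | D.margin a x < 0}} ≤
      2 ^ (m + 1) * Real.exp (-(α * N / 2)) := by
  have : Nonempty (Fin N) := ⟨⟨0, hN⟩⟩
  have hts : ∀ t ∈ D.negSurrogate :: D.ties, ConvexOn ℝ Set.univ t ∧ Continuous t :=
    List.forall_mem_cons.2
      ⟨⟨convexOn_negSurrogate hh_affine, continuous_negSurrogate hh_affine⟩, hties⟩
  simp only [selected_eq_scenarioOptimal] at hunique ⊢
  simpa only [finrank_fin_fun, Fintype.card_fin] using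
    measureReal_scenario_violation_le hPX (isCompact_parameterSet hh_affine)
      (convex_parameterSet hh_affine) (continuous_margin hh_affine)
      (measurable_margin hf hh_meas hw_meas) (convex_setOf_margin_nonneg hh_affine) hts hunique hα

theorem measure_S_ne_zero {P : Measure (EuclideanSpace ℝ (Fin n))} (hPX : ∀ᵐ x ∂P, x ∈ D.X)
    {a : Fin m → ℝ} (hcont : ContinuousWithinAt (D.h a) D.X D.x₀)
    (hsupp : ∀ V ∈ 𝓝 D.x₀, P V ≠ 0) (hpos : 0 < D.h a D.x₀) : P (D.S a) ≠ 0 := by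
  intro hzero
  have hnhds : ∀ᶠ x in 𝓝 D.x₀, x ∈ D.X → 0 < D.h a x :=
    eventually_nhdsWithin_iff.1 (hcont.eventually (lt_mem_nhds hpos))
  refine hsupp _ hnhds (measure_mono_null_ae ?_ hzero)
  filter_upwards [hPX] with x hx hV
  exact ⟨hx, (hV hx).le⟩

end CSISData

theorem theorem1_general {n s m M N' : ℕ} (D : CSISData n s m M N')
    (P : Measure (EuclideanSpace ℝ (Fin n))) [IsProbabilityMeasure P] (hPX : ∀ᵐ x ∂P, x ∈ D.X)
    (hf : ∀ j, Measurable fun x => D.f x (D.u j))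
    (hh_affine : ∀ x, ∃ (L : (Fin m → ℝ) →ₗ[ℝ] ℝ) (c : ℝ), ∀ a, D.h a x = L a + c)
    (hh_neg : ∀ a, ∀ x, x ∉ D.X → D.h a x < 0) (hh_meas : ∀ a, Measurable (D.h a))
    (hu : ∀ j, D.u j ∈ D.U) (hw_meas : ∀ j, Measurable (D.w j))
    (hw_nonneg : ∀ j, ∀ x ∈ D.X, 0 ≤ D.w j x) (hw_sum : ∀ x ∈ D.X, ∑ j, D.w j x = 1)
    (hε₀ : 0 < D.ε₀) (hγ : 0 ≤ D.γ) {α β : ℝ} (hα : α ≤ 1) (hβ : 0 < β) {N : ℕ} (hN : 0 < N)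
    (hties : ∀ t ∈ D.ties, ConvexOn ℝ Set.univ t ∧ Continuous t)
    (hunique : ∀ ω : Fin N → EuclideanSpace ℝ (Fin n), (∀ i, ω i ∈ D.X) →
      (D.selected ω).Subsingleton)
    (hαN : 2 / (N : ℝ) * (Real.log (1 / β) + m + 1) ≤ α) :
    (∃ E : Set (Fin N → EuclideanSpace ℝ (Fin n)), MeasurableSet E ∧
      1 - β ≤ (Measure.pi fun _ : Fin N => P).real E ∧
      ∀ ω ∈ E, ∀ a lam, D.IsSolution ω a lam → lam = 0 → P (D.S a) ≠ 0 →
        D.IsProbabilisticCSISFor P α (D.S a)) ∧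
    ((∀ a, ContinuousOn (D.h a) D.X) → (∀ V ∈ 𝓝 D.x₀, P V ≠ 0) →
      ∀ ω : Fin N → EuclideanSpace ℝ (Fin n), ∀ a lam, D.IsSolution ω a lam →
        P (D.S a) ≠ 0) := by
  replace hh_affine : ∀ x, ∃ A : (Fin m → ℝ) →ᵃ[ℝ] ℝ, ∀ a, D.h a x = A a := fun x =>
    let ⟨L, c, hL⟩ := hh_affine x
    ⟨L.toAffineMap + AffineMap.const ℝ _ c, hL⟩
  refine ⟨?_, fun hcont hsupp ω a lam hsol => ?_⟩
  · set bad := {ω : Fin N → EuclideanSpace ℝ (Fin n) |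
      ∃ a ∈ D.selected ω, α < P.real {x | D.margin a x < 0}}
    have hbad : (Measure.pi fun _ => P).real bad ≤ β :=
      (CSISData.measureReal_selected_violation_le hPX hf hh_affine hh_meas hw_meas hN hties hunique
        hα).trans (two_pow_mul_exp_le (Nat.cast_pos.2 hN) hβ (by push_cast; rwa [← add_assoc]))
    obtain ⟨E', hbadE', hE', hmeas⟩ := exists_measurable_superset (Measure.pi fun _ => P) bad
    refine ⟨E'ᶜ, hE'.compl, ?_, fun ω hω a lam hsol hlam hne => ?_⟩
    · rw [probReal_compl_eq_one_sub hE', measureReal_def, hmeas]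
      exact sub_le_sub_left hbad 1
    · have hviol : P.real {x | D.margin a x < 0} ≤ α := not_lt.1 fun hlt =>
        hω (hbadE' ⟨a, hsol.tie_break hlam, hlt⟩)
      exact CSISData.isProbabilisticCSISFor_S hh_neg hu hw_nonneg hw_sum hγ (hh_meas a) hviol hne
  · have hpos : 0 < D.h a D.x₀ := hε₀.trans_le hsol.optimal.1.1
    have hx₀ : D.x₀ ∈ D.X := by_contra fun hX => (hh_neg a _ hX).not_gt hpos
    exact CSISData.measure_S_ne_zero hPX (hcont a _ hx₀) hsupp hpos

theorem theorem1 {n s m M N' : ℕ} (D : CSISData n s m M N')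
    -- the safe set carries a uniform distribution
    (hX : MeasurableSet D.X) (hX_pos : volume D.X ≠ 0) (hX_fin : volume D.X ≠ ⊤)
    -- compact control set, continuous dynamics
    (hU : IsCompact D.U)
    (hf : ContinuousOn (Function.uncurry D.f) (Set.univ ×ˢ D.U))
    -- the template is affine in the parameters, negative outside the safe set, and measurable
    (hh_affine : ∀ x, ∃ (L : (Fin m → ℝ) →ₗ[ℝ] ℝ) (c : ℝ), ∀ a, D.h a x = L a + c)
    (hh_neg : ∀ a, ∀ x, x ∉ D.X → D.h a x < 0)
    (hh_meas : ∀ a, Measurable (D.h a))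
    -- sampled controls and fixed weight functions
    (hu : ∀ j, D.u j ∈ D.U)
    (hw_meas : ∀ j, Measurable (D.w j))
    (hw_nonneg : ∀ j, ∀ x ∈ D.X, 0 ≤ D.w j x)
    (hw_sum : ∀ x ∈ D.X, ∑ j, D.w j x = 1)
    -- the remaining parameters
    (hx₀ : D.x₀ ∈ D.X) (hε₀ : 0 < D.ε₀) (hγ : D.γ ∈ Set.Ioo (0 : ℝ) 1)
    (hlam : 0 < D.lamBar) (hbound : ∀ l, D.ε₀ ≤ D.bound l)
    (hx' : ∀ i, D.x' i ∈ D.X)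
    (α β : ℝ) (hα : α ∈ Set.Ioo (0 : ℝ) 1) (hβ : β ∈ Set.Ioo (0 : ℝ) 1)
    (N : ℕ) (hN : 0 < N)
    -- convex tie-break functions that single out one optimum
    (hties : ∀ t ∈ D.ties, ConvexOn ℝ Set.univ t ∧ Continuous t)
    (hunique : ∀ ω : Fin N → EuclideanSpace ℝ (Fin n), (∀ i, ω i ∈ D.X) →
      (D.selected ω).Subsingleton)
    (hαN : 2 / (N : ℝ) * (Real.log (1 / β) + m + 1) ≤ α) :
    -- with confidence at least `1 - β`, if `λ* = 0` then the computed set is invariant up to `α`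
    (∃ E : Set (Fin N → EuclideanSpace ℝ (Fin n)), MeasurableSet E ∧
      1 - β ≤ (Measure.pi fun _ : Fin N => D.P).real E ∧
      ∀ ω ∈ E, ∀ a lam, D.IsSolution ω a lam → lam = 0 → D.P (D.S a) ≠ 0 →
        D.IsProbabilisticCSIS α (D.S a)) ∧
    -- the computed set is never null if `h` is continuous on the safe set and
    -- `x₀` is in the support of the uniform distribution
    ((∀ a, ContinuousOn (D.h a) D.X) → (∀ V ∈ 𝓝 D.x₀, D.P V ≠ 0) →
      ∀ ω : Fin N → EuclideanSpace ℝ (Fin n), ∀ a lam, D.IsSolution ω a lam →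
        D.P (D.S a) ≠ 0) := by
  have : IsProbabilityMeasure D.P :=
    ProbabilityTheory.cond_isProbabilityMeasure_of_finite hX_pos hX_fin
  exact theorem1_general D D.P (ProbabilityTheory.ae_cond_mem hX)
    (fun j => (hf.comp_continuous (.prodMk_left (D.u j)) fun _ => ⟨trivial, hu j⟩).measurable)
    hh_affine hh_neg hh_meas hu hw_meas hw_nonneg hw_sum hε₀ hγ.1.le hα.2.le hβ.1 hN hties hunique
    hαN
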